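/- Let $n\ge 1$ and let $X=\{X_t\}_{t\ge 0}$ be a Lévy process on $\mathbb{R}^n$ (that is, $X_0=0$ a.s., càdlàg paths, stationary and independent increments), with characteristic exponent $\Psi:\mathbb{R}^n\to\mathbb{C}$, the continuous function with $\mathbf{E}\,e^{i\langle \xi,X_t\rangle}=e^{-t\Psi(\xi)}$ for all $t\ge 0$ and $\xi\in\mathbb{R}^n$. Assume that 1. $\displaystyle\liminf_{\|\xi\|\to\infty}\frac{\log \operatorname{Re}\Psi(\xi)}{\log\|\xi\|}=\beta_\infty$ for some $\beta_\infty\in(0,2)$ (with $\log 0=-\infty$); 2. $\displaystyle\int_{\{\|\xi\|\le 1\}}\frac{|\Psi(\xi)|}{\|\xi\|^{n+\beta_0}}\,d\xi<\infty$ for some $\beta_0\in(0,1)$. Then for every $t>0$ the law of $X_t$ has a density $p_t$ with respect to Lebesgue measure on $\mathbb{R}^n$. Moreover, for every $T>0$ and $\kappa\in(0,\beta_0/2)$ there is a constant $C>0$, depending only on $T$, $\kappa$, $\beta_\infty$, $\beta_0$ and the law of the process, such that for all $\theta,\tau,\omega\in(0,1)$, all $t\in(0,T)$, all $h\in\mathbb{R}^n$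 with $\|h\|\le 1$ and all $\varepsilon>0$, $$\int_{\mathbb{R}^n}|p_t(x+h)-p_t(x)|\,dx\le C\left(\frac{\|h\|^{\theta}}{t^{\frac{\theta+n}{\beta_\infty}+\kappa}}\right)^{\frac{\tau\beta_0}{n+\beta_0}},$$ $$\int_{\mathbb{R}^n}|p_{t+\varepsilon}(x)-p_t(x)|\,dx\le C\left(\frac{\varepsilon^{\theta}}{t^{\frac{2\theta+n}{\beta_\infty}+\kappa}}\right)^{\frac{\omega\beta_0}{n+\beta_0}}.$$ -/

import Mathlib

open MeasureTheory ProbabilityTheory Filter Topology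
open scoped NNReal ENNReal

/-- A path indexed by `[0, ∞)` is càdlàg: right-continuous, with left limits. -/
def IsCadlagPath {E : Type*} [TopologicalSpace E] (f : ℝ≥0 → E) : Prop :=
  (∀ t, ContinuousWithinAt f (Set.Ici t) t) ∧ ∀ t, 0 < t → ∃ l, Tendsto f (𝓝[<] t) (𝓝 l)

/-- `X` is a Lévy process on `ℝⁿ` under the measure `P`. -/
structure IsLevyProcess {Ω : Type*} [MeasurableSpace Ω] {n : ℕ} (P : Measure Ω)
    (X : ℝ≥0 → Ω → EuclideanSpace ℝ (Fin n)) : Prop where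
  measurable : ∀ t, Measurable (X t)
  zero : ∀ᵐ ω ∂P, X 0 ω = 0
  cadlag : ∀ᵐ ω ∂P, IsCadlagPath fun t => X t ω
  indep_increments : HasIndepIncrements X P
  stationary_increments : ∀ s t, IdentDistrib (X (s + t) - X s) (X t - X 0) P P

/-- `Ψ` is the characteristic exponent of `X`: it is continuous and
`E exp(i⟨ξ, X_t⟩) = exp(-t Ψ(ξ))` for all `t ≥ 0` and all `ξ`. -/
structure IsCharExponent {Ω : Type*} [MeasurableSpace Ω] {n : ℕ} (P : Measure Ω)
    (X : ℝ≥0 → Ω → EuclideanSpace ℝ (Fin n)) (Ψ : EuclideanSpace ℝ (Fin n) → ℂ) : Prop where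
  continuous : Continuous Ψ
  charFun_eq : ∀ (t : ℝ≥0) (ξ : EuclideanSpace ℝ (Fin n)),
    charFun (P.map (X t)) ξ = Complex.exp (-((t : ℝ) : ℂ) * Ψ ξ)

/-- The lower growth index of `Re Ψ` at infinity,
`liminf_{‖ξ‖ → ∞} log (Re Ψ(ξ)) / log ‖ξ‖`, computed in `[-∞, ∞]` with `log 0 = -∞`. -/
noncomputable def lowerIndexAtInfinity {n : ℕ} (Ψ : EuclideanSpace ℝ (Fin n) → ℂ) : EReal :=
  liminf (fun ξ => ENNReal.log (ENNReal.ofReal (Ψ ξ).re) / ((Real.log ‖ξ‖ : ℝ) : EReal))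
    (Bornology.cobounded (EuclideanSpace ℝ (Fin n)))

/-- For every `t > 0`, `p t` is a density of the law of `X t` with respect to Lebesgue measure. -/
def IsTransitionDensity {Ω : Type*} [MeasurableSpace Ω] {n : ℕ} (P : Measure Ω)
    (X : ℝ≥0 → Ω → EuclideanSpace ℝ (Fin n)) (p : ℝ≥0 → EuclideanSpace ℝ (Fin n) → ℝ) : Prop :=
  ∀ t, 0 < t → Measurable (p t) ∧ (∀ x, 0 ≤ p t x) ∧
    P.map (X t) = volume.withDensity fun x => ENNReal.ofReal (p t x)

/-! The `L¹` distances are interpolated between a uniform bound on the difference of densities and a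
polynomial tail bound.

Uniform bound. For `b < β_∞` the index at infinity gives `Re Ψ(ξ) ≥ ‖ξ‖^b - c`, so the
characteristic function of `X_t` is at most `e^{ct} exp(-t‖ξ‖^b)`. It is integrable, hence Fourier
inversion yields a density. A shift by `h` multiplies the integrand by `e^{i⟨ξ,h⟩} - 1`, of size at
most a constant times `‖h‖^θ (1+‖ξ‖)^θ`; a time step `ε` multiplies it by `e^{-εΨ} - 1`, of size at
most a constant times `ε^θ (1+‖ξ‖)^{2θ}`, because `Ψ` grows at most quadratically. Scaling `ξ =
t^{-1/b} u` produces the powers of `t`, and `κ` pays for replacing `b` by `β_∞`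
(`exists_integral_one_add_norm_rpow_mul_norm_charFun_le`).

Tail. The truncation inequality bounds `P(‖X_t‖ ≥ R)` by the mean of `1 - Re φ_t` over a ball of
radius `2π/R`, and the integrability of `Ψ` at the origin turns this into `C R^{-β₀}`
(`exists_measureReal_le_norm_le`).

Interpolation. If the uniform bound has size `A`, the ball of radius `R` contributes `R^n A` and its
complement `R^{-β₀}`. The choice `R ≈ A^{-1/(n+β₀)}` gives `A^{β₀/(n+β₀)}`
(`integral_abs_le_of_sup_le_of_tail_le`). The factors `τ, ω < 1` only weaken this when `A ≤ 1`; when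
`A ≥ 1` the total mass 2 suffices. -/

/-! ### Fourier inversion for probability measures with integrable characteristic function -/

section FourierInversion

open scoped FourierTransform SchwartzMap ContDiff RealInnerProductSpace

variable {V : Type*} [NormedAddCommGroup V] [InnerProductSpace ℝ V] [FiniteDimensional ℝ V]
  [MeasurableSpace V] [BorelSpace V]

/-- The function with characteristic function `φ`, for integrable `φ`. -/
noncomputable def charFunInv (φ : V → ℂ) : V → ℂ :=
  𝓕⁻ fun ξ => φ (-(2 * Real.pi) • ξ)

theorem integrable_comp_neg_two_pi_smul {φ : V → ℂ} (hφ : Integrable φ) :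
    Integrable fun ξ : V => φ (-(2 * Real.pi) • ξ) :=
  hφ.comp_smul (by simp [Real.pi_ne_zero])

/-- Write `g = 𝓕 (𝓕⁻ g)` and use self-adjointness of the Fourier transform twice: once to move `𝓕`
onto `μ`, once to move `𝓕⁻` from `g` onto the characteristic function. -/
theorem integral_schwartz_eq_integral_mul_charFunInv (μ : Measure V) [IsProbabilityMeasure μ]
    (hφ : Integrable (charFun μ)) (g : 𝓢(V, ℂ)) :
    ∫ x, g x ∂μ = ∫ x, g x * charFunInv (charFun μ) x := by
  have hm := integrable_comp_neg_two_pi_smul hφ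
  have hinner : Continuous fun p : V × V => innerₗ V p.1 p.2 := continuous_inner
  have hninner : Continuous fun p : V × V => (-innerₗ V) p.1 p.2 := continuous_inner.neg
  have hflip : (innerₗ V).flip = innerₗ V := by
    ext x y; simp
  have hnflip : (-innerₗ V).flip = -innerₗ V := by
    ext x y; simp [real_inner_comm]
  have h1 := VectorFourier.integral_fourierIntegral_smul_eq_flip (μ := volume) (ν := μ)
    (L := innerₗ V) (e := Real.fourierChar) (f := (𝓕⁻ g : 𝓢(V, ℂ))) (g := fun _ => (1 : ℂ))
    Real.continuous_fourierChar hinner (𝓕⁻ g : 𝓢(V, ℂ)).integrable (integrable_const _)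
  have h2 := VectorFourier.integral_fourierIntegral_smul_eq_flip (μ := volume) (ν := volume)
    (L := -innerₗ V) (e := Real.fourierChar) (f := g)
    (g := fun ξ : V => charFun μ (-(2 * Real.pi) • ξ))
    Real.continuous_fourierChar hninner g.integrable hm
  rw [hflip] at h1
  rw [hnflip] at h2
  have e1 : VectorFourier.fourierIntegral Real.fourierChar volume (innerₗ V)
      (𝓕⁻ g : 𝓢(V, ℂ)) = g := by
    change 𝓕 ((𝓕⁻ g : 𝓢(V, ℂ)) : V → ℂ) = g
    rw [← SchwartzMap.fourier_coe, FourierTransform.fourier_fourierInv_eq]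
  have e2 : ((𝓕⁻ g : 𝓢(V, ℂ)) : V → ℂ) =
      VectorFourier.fourierIntegral Real.fourierChar volume (-innerₗ V) g := by
    rw [SchwartzMap.fourierInv_coe]; rfl
  have e3 : VectorFourier.fourierIntegral Real.fourierChar μ (innerₗ V) (fun _ => (1 : ℂ)) =
      fun ξ : V => charFun μ (-(2 * Real.pi) • ξ) := by
    ext ξ
    rw [charFun_eq_fourierIntegral', smul_smul]
    have : -(2 * Real.pi)⁻¹ * -(2 * Real.pi) = 1 := by
      field_simp
    rw [this, one_smul]; rfl
  rw [e1, e3] at h1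
  rw [← e2] at h2
  simp only [smul_eq_mul, mul_one] at h1 h2
  rw [h1, h2]
  rfl

theorem norm_charFunInv_le (φ : V → ℂ) (x : V) :
    ‖charFunInv φ x‖ ≤ ∫ ξ : V, ‖φ (-(2 * Real.pi) • ξ)‖ :=
  VectorFourier.norm_fourierIntegral_le_integral_norm _ _ _ _ _

theorem continuous_charFunInv {φ : V → ℂ} (hφ : Integrable φ) : Continuous (charFunInv φ) :=
  VectorFourier.fourierIntegral_continuous Real.continuous_fourierChar
    (continuous_inner.neg : Continuous fun p : V × V => (-innerₗ V) p.1 p.2)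
    (integrable_comp_neg_two_pi_smul hφ)

/-- A probability measure with integrable characteristic function has the density given by
Fourier inversion. -/
theorem eq_withDensity_of_integrable_charFun (μ : Measure V) [IsProbabilityMeasure μ]
    (hφ : Integrable (charFun μ)) :
    μ = volume.withDensity fun x => ENNReal.ofReal (charFunInv (charFun μ) x).re := by
  set q := charFunInv (charFun μ) with hq
  have hqc : Continuous q := continuous_charFunInv hφ
  -- Absolute continuity of `μ` is not known yet, so `μ` and Lebesgue measure are compared through
  -- their densities `f` and `g` with respect to the dominating measure `ν`.
  set ν : Measure V := μ + volume with hν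
  have : IsLocallyFiniteMeasure ν := ⟨fun x => by
    obtain ⟨s, hs, hsv⟩ := (volume : Measure V).finiteAt_nhds x
    exact ⟨s, hs, ENNReal.add_lt_top.2 ⟨measure_lt_top μ s, hsv⟩⟩⟩
  have hμν : μ ≪ ν := Measure.absolutelyContinuous_of_le (Measure.le_add_right le_rfl)
  have hvν : (volume : Measure V) ≪ ν :=
    Measure.absolutelyContinuous_of_le (Measure.le_add_left le_rfl)
  have hg1 : (volume : Measure V).rnDeriv ν ≤ᵐ[ν] 1 :=
    Measure.rnDeriv_le_one_of_le (Measure.le_add_left le_rfl)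
  set f : V → ℝ := fun x => (μ.rnDeriv ν x).toReal with hf
  set g : V → ℝ := fun x => ((volume : Measure V).rnDeriv ν x).toReal with hg
  have hgm : Measurable g := (Measure.measurable_rnDeriv _ _).ennreal_toReal
  have hfint : Integrable f ν := Measure.integrable_toReal_rnDeriv
  -- Both sides are locally integrable for `ν`, as `g ≤ 1` and `q` is bounded, so it is enough to
  -- test against smooth compactly supported functions, which are Schwartz.
  have key : ∀ᵐ x ∂ν, (f x : ℂ) = (g x : ℂ) * q x := by
    apply ae_eq_of_integral_contDiff_smul_eq
    · exact hfint.ofReal.locallyIntegrable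
    · have hc : LocallyIntegrable (fun _ : V => ∫ ξ : V, ‖charFun μ (-(2 * Real.pi) • ξ)‖) ν :=
        locallyIntegrable_const _
      refine hc.mono (by fun_prop) ?_
      filter_upwards [hg1] with x hx
      have hx' : g x ≤ 1 := by
        have := ENNReal.toReal_mono ENNReal.one_ne_top hx
        simpa using this
      rw [norm_mul, Complex.norm_real, Real.norm_of_nonneg ENNReal.toReal_nonneg,
        Real.norm_of_nonneg (by positivity)]
      exact (mul_le_of_le_one_left (norm_nonneg _) hx').trans (norm_charFunInv_le _ _)
    · intro u hu huc
      have hu1 : ContDiff ℝ ∞ fun x => (u x : ℂ) := Complex.ofRealCLM.contDiff.comp hu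
      have hu2 : HasCompactSupport fun x => (u x : ℂ) :=
        huc.comp_left (g := fun r : ℝ => (r : ℂ)) Complex.ofReal_zero
      have hS := integral_schwartz_eq_integral_mul_charFunInv μ hφ (hu2.toSchwartzMap hu1)
      simp only [HasCompactSupport.toSchwartzMap_toFun] at hS
      have a1 := integral_rnDeriv_smul (f := fun x => (u x : ℂ)) hμν
      have a2 := integral_rnDeriv_smul (f := fun x => (u x : ℂ) * q x) hvν
      calc ∫ x, u x • (f x : ℂ) ∂ν = ∫ x, f x • (u x : ℂ) ∂ν := by
            congr 1; ext x; simp [mul_comm]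
        _ = ∫ x, (u x : ℂ) ∂μ := a1
        _ = ∫ x, (u x : ℂ) * q x := hS
        _ = ∫ x, g x • ((u x : ℂ) * q x) ∂ν := a2.symm
        _ = ∫ x, u x • ((g x : ℂ) * q x) ∂ν := by
            congr 1; ext x; simp only [Complex.real_smul]; ring
  have hae : μ.rnDeriv ν =ᵐ[ν]
      (volume : Measure V).rnDeriv ν * fun x => ENNReal.ofReal (q x).re := by
    filter_upwards [key, Measure.rnDeriv_ne_top μ ν, hg1] with x hx h1 h2
    have hx' : f x = g x * (q x).re := by
      have := congrArg Complex.re hx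
      simpa using this
    rw [Pi.mul_apply, ← ENNReal.ofReal_toReal h1,
      ← ENNReal.ofReal_toReal (a := (volume : Measure V).rnDeriv ν x)
        (ne_top_of_le_ne_top ENNReal.one_ne_top h2), ← ENNReal.ofReal_mul ENNReal.toReal_nonneg]
    exact congrArg _ hx'
  calc μ = ν.withDensity (μ.rnDeriv ν) := (Measure.withDensity_rnDeriv_eq _ _ hμν).symm
    _ = ν.withDensity ((volume : Measure V).rnDeriv ν * fun x => ENNReal.ofReal (q x).re) :=
        withDensity_congr_ae hae
    _ = (ν.withDensity ((volume : Measure V).rnDeriv ν)).withDensity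
          fun x => ENNReal.ofReal (q x).re :=
        withDensity_mul _ (Measure.measurable_rnDeriv _ _)
          (Complex.measurable_re.comp hqc.measurable).ennreal_ofReal
    _ = _ := by rw [Measure.withDensity_rnDeriv_eq _ _ hvν]

/-- Identifies an arbitrary density, so that the final constants need not depend on its choice. The
maximum with 0 mirrors the truncation in `ENNReal.ofReal` and spares a proof that the inverse
transform is nonnegative. -/
theorem density_ae_eq_charFunInv (μ : Measure V) [IsProbabilityMeasure μ]
    (hφ : Integrable (charFun μ)) {p : V → ℝ} (hp : Measurable p) (hp0 : ∀ x, 0 ≤ p x)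
    (hμ : μ = volume.withDensity fun x => ENNReal.ofReal (p x)) :
    ∀ᵐ x, p x = max (charFunInv (charFun μ) x).re 0 := by
  have hqm : Measurable fun x => ENNReal.ofReal (charFunInv (charFun μ) x).re :=
    (Complex.measurable_re.comp (continuous_charFunInv hφ).measurable).ennreal_ofReal
  have h := hμ.symm.trans (eq_withDensity_of_integrable_charFun μ hφ)
  rw [withDensity_eq_iff_of_sigmaFinite hp.ennreal_ofReal.aemeasurable hqm.aemeasurable] at h
  filter_upwards [h] with x hx
  have := congrArg ENNReal.toReal hx
  rwa [ENNReal.toReal_ofReal (hp0 x), ENNReal.toReal_ofReal'] at this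

end FourierInversion

/-! ### Growth of the characteristic exponent -/

section CharExponent

open scoped RealInnerProductSpace

/-- Doubling inequality for characteristic functions. -/
theorem norm_one_sub_charFun_two_smul_le {V : Type*} [NormedAddCommGroup V]
    [InnerProductSpace ℝ V] [MeasurableSpace V] [BorelSpace V] [SecondCountableTopology V]
    (μ : Measure V) [IsProbabilityMeasure μ] (ξ : V) :
    ‖1 - charFun μ ((2 : ℝ) • ξ)‖ ≤ 4 * ‖1 - charFun μ ξ‖ := by
  set e : V → ℂ := fun x => Complex.exp (⟪x, ξ⟫ * Complex.I) with he
  have hec : Continuous e := by fun_prop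
  have hen : ∀ x, ‖e x‖ = 1 := fun x => Complex.norm_exp_ofReal_mul_I _
  have hei : Integrable e μ :=
    Integrable.of_bound hec.aestronglyMeasurable 1 (.of_forall fun x => (hen x).le)
  have h1 : charFun μ ξ = ∫ x, e x ∂μ := rfl
  have h2 : charFun μ ((2 : ℝ) • ξ) = ∫ x, e x ^ 2 ∂μ := by
    rw [charFun_apply]
    congr 1; ext x
    rw [he, ← Complex.exp_nat_mul, inner_smul_right]
    push_cast; ring_nf
  have hsi : Integrable (fun x => (e x - 1) ^ 2) μ :=
    Integrable.of_bound (by fun_prop) 4 (.of_forall fun x => by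
      rw [norm_pow]
      have : ‖e x - 1‖ ≤ 2 := (norm_sub_le _ _).trans (by rw [hen]; norm_num)
      nlinarith [norm_nonneg (e x - 1)])
  -- Integrates `1 - e² = 2(1 - e) - (e - 1)²`.
  have h3 : 1 - charFun μ ((2 : ℝ) • ξ) = 2 * (1 - charFun μ ξ) - ∫ x, (e x - 1) ^ 2 ∂μ := by
    have : ∫ x, e x ^ 2 ∂μ = ∫ x, ((e x - 1) ^ 2 + (2 * e x - 1)) ∂μ := by
      congr 1; ext x; ring
    rw [h2, this, integral_add hsi (g := fun x => 2 * e x - 1)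
        ((hei.const_mul 2).sub (integrable_const 1)),
      integral_sub (hei.const_mul 2) (integrable_const 1), integral_const_mul, h1]
    simp
    ring
  have h4 : ‖∫ x, (e x - 1) ^ 2 ∂μ‖ ≤ 2 * ‖1 - charFun μ ξ‖ := by
    -- Since `|e| = 1`, `|e - 1|² = 2 Re(1 - e)`; the quadratic term thus costs another factor 2,
    -- for a total of 4.
    have hsq : ∀ x, ‖(e x - 1) ^ 2‖ = (2 * (1 - e x)).re := fun x => by
      have hx := hen x
      rw [norm_pow, ← Complex.normSq_eq_norm_sq]
      have h5 : Complex.normSq (e x) = 1 := by rw [Complex.normSq_eq_norm_sq, hx, one_pow]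
      rw [Complex.normSq_apply] at h5 ⊢
      simp
      linarith
    calc ‖∫ x, (e x - 1) ^ 2 ∂μ‖ ≤ ∫ x, ‖(e x - 1) ^ 2‖ ∂μ := norm_integral_le_integral_norm _
      _ = ∫ x, (2 * (1 - e x)).re ∂μ := by simp_rw [hsq]
      _ = (∫ x, 2 * (1 - e x) ∂μ).re :=
          integral_re (𝕜 := ℂ) (((integrable_const 1).sub hei).const_mul 2)
      _ = (2 * (1 - charFun μ ξ)).re := by
          rw [integral_const_mul, integral_sub (integrable_const 1) hei, h1]; simp
      _ ≤ ‖2 * (1 - charFun μ ξ)‖ := Complex.re_le_norm _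
      _ = 2 * ‖1 - charFun μ ξ‖ := by simp
  rw [h3]
  refine (norm_sub_le _ _).trans ?_
  rw [norm_mul, Complex.norm_ofNat]
  linarith

/-- An inequality between `1 - exp (-t z)` and `1 - exp (-t w)` for small `t` passes to the
first order in `t`. -/
theorem norm_le_mul_norm_of_forall_one_sub_exp {z w : ℂ} {c : ℝ}
    (h : ∀ t : ℝ, 0 < t →
      ‖1 - Complex.exp (-(t : ℂ) * z)‖ ≤ c * ‖1 - Complex.exp (-(t : ℂ) * w)‖) :
    ‖z‖ ≤ c * ‖w‖ := by
  have key : ∀ z : ℂ, Tendsto (fun t : ℝ => t⁻¹ * ‖1 - Complex.exp (-(t : ℂ) * z)‖)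
      (𝓝[>] 0) (𝓝 ‖z‖) := fun z => by
    have hd : HasDerivAt (fun t : ℝ => Complex.exp (-(t : ℂ) * z)) (-z) 0 := by
      have h1 : HasDerivAt (fun t : ℝ => -(t : ℂ) * z) (-1 * z) 0 :=
        ((Complex.ofRealCLM.hasDerivAt (x := 0)).neg).mul_const z
      simpa using h1.cexp
    have := hd.tendsto_slope_zero_right.norm
    rw [norm_neg] at this
    refine this.congr' ?_
    filter_upwards [self_mem_nhdsWithin] with t ht
    rw [norm_smul, Real.norm_of_nonneg (inv_nonneg.2 (le_of_lt ht)), norm_sub_rev]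
    simp
  refine le_of_tendsto_of_tendsto (key z) ((key w).const_mul c) ?_
  filter_upwards [self_mem_nhdsWithin] with t ht
  have := mul_le_mul_of_nonneg_left (h t ht) (inv_nonneg.2 (le_of_lt ht))
  linarith

variable {Ω : Type*} [MeasurableSpace Ω] {n : ℕ} {P : Measure Ω} [IsProbabilityMeasure P]
  {X : ℝ≥0 → Ω → EuclideanSpace ℝ (Fin n)} {Ψ : EuclideanSpace ℝ (Fin n) → ℂ}

theorem IsLevyProcess.isProbabilityMeasure_map (hX : IsLevyProcess P X) (t : ℝ≥0) :
    IsProbabilityMeasure (P.map (X t)) :=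
  Measure.isProbabilityMeasure_map (hX.measurable t).aemeasurable

theorem IsCharExponent.re_nonneg (hX : IsLevyProcess P X) (hΨ : IsCharExponent P X Ψ)
    (ξ : EuclideanSpace ℝ (Fin n)) : 0 ≤ (Ψ ξ).re := by
  have := hX.isProbabilityMeasure_map 1
  have h := norm_charFun_le_one (μ := P.map (X 1)) ξ
  rw [hΨ.charFun_eq, Complex.norm_exp] at h
  simpa using h

theorem IsCharExponent.map_zero (hX : IsLevyProcess P X) (hΨ : IsCharExponent P X Ψ) :
    Ψ 0 = 0 := by
  -- The comparison with constant 0: `exp(-tΨ(0)) = 1` for every `t > 0` forces `Ψ(0) = 0`.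
  have : ‖Ψ 0‖ ≤ 0 * ‖(0 : ℂ)‖ := by
    refine norm_le_mul_norm_of_forall_one_sub_exp fun t ht => ?_
    lift t to ℝ≥0 using ht.le
    have := hX.isProbabilityMeasure_map t
    rw [← hΨ.charFun_eq t 0, charFun_zero]
    simp
  simpa using this

theorem IsCharExponent.norm_two_smul_le (hX : IsLevyProcess P X) (hΨ : IsCharExponent P X Ψ)
    (ξ : EuclideanSpace ℝ (Fin n)) : ‖Ψ ((2 : ℝ) • ξ)‖ ≤ 4 * ‖Ψ ξ‖ := by
  refine norm_le_mul_norm_of_forall_one_sub_exp fun t ht => ?_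
  lift t to ℝ≥0 using ht.le
  have := hX.isProbabilityMeasure_map t
  have h := norm_one_sub_charFun_two_smul_le (P.map (X t)) ξ
  rwa [hΨ.charFun_eq, hΨ.charFun_eq] at h

/-- A characteristic exponent grows at most quadratically. -/
theorem IsCharExponent.exists_norm_le (hX : IsLevyProcess P X) (hΨ : IsCharExponent P X Ψ) :
    ∃ M : ℝ, 1 ≤ M ∧ ∀ ξ, ‖Ψ ξ‖ ≤ M * (1 + ‖ξ‖) ^ 2 := by
  obtain ⟨M, hM⟩ := (isCompact_closedBall (0 : EuclideanSpace ℝ (Fin n))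
    1).exists_bound_of_continuousOn hΨ.continuous.continuousOn
  have hM0 : 0 ≤ M := (norm_nonneg _).trans (hM 0 (by simp))
  -- Doubling propagates the bound on the unit ball to the ball of radius `2^k`, at the price of
  -- `4^k`.
  have step : ∀ k : ℕ, ∀ ξ : EuclideanSpace ℝ (Fin n), ‖ξ‖ ≤ 2 ^ k → ‖Ψ ξ‖ ≤ 4 ^ k * M := by
    intro k
    induction k with
    | zero => intro ξ hξ; simpa using hM ξ (by simpa using hξ)
    | succ k ih =>
      intro ξ hξ
      have h1 : ‖(2⁻¹ : ℝ) • ξ‖ ≤ 2 ^ k := by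
        rw [norm_smul, Real.norm_of_nonneg (by norm_num)]
        rw [pow_succ] at hξ; linarith
      have h2 := hΨ.norm_two_smul_le hX ((2⁻¹ : ℝ) • ξ)
      rw [smul_smul, mul_inv_cancel₀ two_ne_zero, one_smul] at h2
      calc ‖Ψ ξ‖ ≤ 4 * ‖Ψ ((2⁻¹ : ℝ) • ξ)‖ := h2
        _ ≤ 4 * (4 ^ k * M) := by gcongr; exact ih _ h1
        _ = 4 ^ (k + 1) * M := by ring
  refine ⟨4 * M + 1, by linarith, fun ξ => ?_⟩
  rcases le_total ‖ξ‖ 1 with h | h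
  · have := step 0 ξ (by simpa using h)
    nlinarith [norm_nonneg ξ, sq_nonneg (‖ξ‖)]
  · obtain ⟨k, hk1, hk2⟩ := exists_nat_pow_near h one_lt_two
    have h1 := step (k + 1) ξ hk2.le
    have h2 : (4 : ℝ) ^ k ≤ ‖ξ‖ ^ 2 := by
      have : (4 : ℝ) ^ k = (2 ^ k) ^ 2 := by rw [← pow_mul, mul_comm, pow_mul]; norm_num
      rw [this]; gcongr
    calc ‖Ψ ξ‖ ≤ 4 ^ (k + 1) * M := h1
      _ = 4 * M * 4 ^ k := by ring
      _ ≤ 4 * M * ‖ξ‖ ^ 2 := by gcongr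
      _ ≤ (4 * M + 1) * (1 + ‖ξ‖) ^ 2 := by gcongr <;> linarith

/-- Mean value inequality on the half-plane `Re ≤ 0`, where the derivative of `exp` has modulus at
most 1. -/
theorem norm_one_sub_exp_neg_le {z : ℂ} (hz : 0 ≤ z.re) : ‖1 - Complex.exp (-z)‖ ≤ ‖z‖ := by
  have h := (convex_halfSpace_re_le 0).norm_image_sub_le_of_norm_hasDerivWithin_le
    (f := Complex.exp) (f' := Complex.exp) (C := 1) (x := -z) (y := 0)
    (fun x _ => (Complex.hasDerivAt_exp x).hasDerivWithinAt)
    (fun x hx => by rw [Complex.norm_exp]; exact Real.exp_le_one_iff.2 hx)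
    (by simpa using hz) (by simp)
  simpa using h

theorem exists_rpow_sub_le_re_of_lt_lowerIndex {b : ℝ} (hb : 0 < b)
    (h0 : ∀ ξ, 0 ≤ (Ψ ξ).re) (h : (b : EReal) < lowerIndexAtInfinity Ψ) :
    ∃ c : ℝ, 0 ≤ c ∧ ∀ ξ, ‖ξ‖ ^ b - c ≤ (Ψ ξ).re := by
  have hev := eventually_lt_of_lt_liminf h
  rw [(hasBasis_cobounded_norm (E := EuclideanSpace ℝ (Fin n))).eventually_iff] at hev
  obtain ⟨L, -, hL⟩ := hev
  -- Inside the ball of radius `max L 2`, `Re Ψ ≥ 0` is enough once `c` absorbs `‖ξ‖^b`; outside it,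
  -- the 2 ensures `log ‖ξ‖ > 0`, so the quotient of logarithms can be cleared.
  refine ⟨(max L 2) ^ b, by positivity, fun ξ => ?_⟩
  rcases le_total ‖ξ‖ (max L 2) with hξ | hξ
  · have : ‖ξ‖ ^ b ≤ (max L 2) ^ b := by gcongr
    linarith [h0 ξ]
  · have h1 := hL (x := ξ) ((le_max_left _ _).trans hξ)
    have h2 : 1 < ‖ξ‖ := by linarith [(le_max_right L 2).trans hξ]
    have hlog : 0 < Real.log ‖ξ‖ := Real.log_pos h2
    rw [EReal.lt_div_iff (by exact_mod_cast hlog) (EReal.coe_ne_top _)] at h1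
    have hpos : 0 < (Ψ ξ).re := by
      by_contra hcon
      rw [ENNReal.ofReal_eq_zero.2 (not_lt.1 hcon), ENNReal.log_zero] at h1
      exact not_lt_bot h1
    rw [ENNReal.log_ofReal_of_pos hpos, ← EReal.coe_mul, EReal.coe_lt_coe_iff] at h1
    have h3 : ‖ξ‖ ^ b ≤ (Ψ ξ).re := by
      rw [Real.rpow_def_of_pos (by linarith), ← Real.le_log_iff_exp_le hpos]
      linarith
    have : 0 ≤ (max L 2) ^ b := by positivity
    linarith

end CharExponent

/-! ### Moments of stretched exponentials -/

section StretchedExponential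

variable {V : Type*} [NormedAddCommGroup V] [NormedSpace ℝ V] [FiniteDimensional ℝ V]
  [Nontrivial V] [MeasurableSpace V] [BorelSpace V] (μ : Measure V) [μ.IsAddHaarMeasure]

theorem integrable_one_add_norm_sq_mul_exp_neg_norm_rpow {b : ℝ} (hb : 0 < b) :
    Integrable (fun u : V => (1 + ‖u‖) ^ 2 * Real.exp (-‖u‖ ^ b)) μ := by
  rw [integrable_fun_norm_addHaar μ (f := fun r => (1 + r) ^ 2 * Real.exp (-r ^ b))]
  have key : ∀ k : ℕ, IntegrableOn (fun y : ℝ => y ^ k * Real.exp (-y ^ b)) (Set.Ioi 0) :=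
    fun k => by
      have := integrableOn_rpow_mul_exp_neg_rpow (p := b) (s := (k : ℝ))
        (by linarith [Nat.cast_nonneg (α := ℝ) k]) hb
      simpa only [Real.rpow_natCast] using this
  set d := Module.finrank ℝ V - 1
  have := ((key d).add ((key (d + 1)).const_mul 2)).add (key (d + 2))
  refine this.congr (.of_forall fun y => ?_)
  simp only [Pi.add_apply, smul_eq_mul]
  ring

/-- Scaling of the moments of a stretched exponential. -/
theorem exists_integral_one_add_norm_rpow_mul_exp_le {b T : ℝ} (hb : 0 < b) (hT : 1 ≤ T) :
    ∃ C : ℝ, 0 < C ∧ ∀ s ∈ Set.Icc (0 : ℝ) 2, ∀ t ∈ Set.Ioc 0 T,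
      Integrable (fun ξ : V => (1 + ‖ξ‖) ^ s * Real.exp (-t * ‖ξ‖ ^ b)) μ ∧
      ∫ ξ, (1 + ‖ξ‖) ^ s * Real.exp (-t * ‖ξ‖ ^ b) ∂μ ≤
        C * t ^ (-((s + Module.finrank ℝ V) / b)) := by
  set J := ∫ u : V, (1 + ‖u‖) ^ 2 * Real.exp (-‖u‖ ^ b) ∂μ with hJ
  have hJ0 : 0 ≤ J := integral_nonneg fun u => by positivity
  have hJi := integrable_one_add_norm_sq_mul_exp_neg_norm_rpow μ hb
  -- The substitution is `ξ = r u` with `t r^b = 1`. Since `r K ≥ 1` for `t ≤ T`, `1 + r‖u‖ ≤ r K (1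
  -- + ‖u‖)`, which extracts the factor `r^s` with a constant uniform in `s ∈ [0, 2]`.
  set K := T ^ b⁻¹ with hK
  have hK1 : 1 ≤ K := Real.one_le_rpow hT (by positivity)
  refine ⟨K ^ 2 * J + 1, by positivity, fun s hs t ht => ?_⟩
  have ht0 : 0 < t := ht.1
  set r := t ^ (-b⁻¹) with hr
  have hr0 : 0 < r := Real.rpow_pos_of_pos ht0 _
  have hrK : 1 ≤ r * K := by
    rw [hr, hK, Real.rpow_neg ht0.le, ← div_eq_inv_mul, one_le_div (by positivity)]
    exact Real.rpow_le_rpow ht0.le ht.2 (by positivity)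
  have htr : t * r ^ b = 1 := by
    rw [hr, ← Real.rpow_mul ht0.le, neg_mul, inv_mul_cancel₀ hb.ne', Real.rpow_neg_one,
      mul_inv_cancel₀ ht0.ne']
  set f : V → ℝ := fun ξ => (1 + ‖ξ‖) ^ s * Real.exp (-t * ‖ξ‖ ^ b) with hf
  have hfm : Measurable f := by fun_prop
  have hbd : ∀ u, f (r • u) ≤ r ^ s * K ^ 2 * ((1 + ‖u‖) ^ 2 * Real.exp (-‖u‖ ^ b)) := fun u => by
    have h1 : -t * ‖r • u‖ ^ b = -‖u‖ ^ b := by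
      rw [norm_smul, Real.norm_of_nonneg hr0.le, Real.mul_rpow hr0.le (norm_nonneg _),
        ← mul_assoc, neg_mul, htr, neg_one_mul]
    have h2 : (1 + ‖r • u‖) ^ s ≤ r ^ s * K ^ 2 * (1 + ‖u‖) ^ 2 := by
      have h3 : 1 + ‖r • u‖ ≤ r * (K * (1 + ‖u‖)) := by
        rw [norm_smul, Real.norm_of_nonneg hr0.le]
        have : r * ‖u‖ ≤ r * K * ‖u‖ := by
          have := mul_le_mul_of_nonneg_left hK1 hr0.le
          nlinarith [norm_nonneg u]
        nlinarith
      calc (1 + ‖r • u‖) ^ s ≤ (r * (K * (1 + ‖u‖))) ^ s :=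
            Real.rpow_le_rpow (by positivity) h3 hs.1
        _ = r ^ s * (K * (1 + ‖u‖)) ^ s := Real.mul_rpow hr0.le (by positivity)
        _ ≤ r ^ s * (K * (1 + ‖u‖)) ^ (2 : ℝ) := by
            gcongr
            · nlinarith [norm_nonneg u]
            · exact hs.2
        _ = r ^ s * K ^ 2 * (1 + ‖u‖) ^ 2 := by rw [Real.rpow_two]; ring
    simp only [hf]
    rw [h1, ← mul_assoc]
    gcongr
  have hf0 : ∀ ξ, 0 ≤ f ξ := fun ξ => by positivity
  have hi : Integrable (fun u => f (r • u)) μ :=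
    (hJi.const_mul (r ^ s * K ^ 2)).mono'
      (hfm.comp (measurable_const_smul r)).aestronglyMeasurable (.of_forall fun u => by
      rw [Real.norm_of_nonneg (hf0 _)]; exact hbd u)
  have hcomp := Measure.integral_comp_smul μ f r
  have hrd : 0 < r ^ Module.finrank ℝ V := by positivity
  refine ⟨(integrable_comp_smul_iff μ f hr0.ne').1 hi, ?_⟩
  have hle : ∫ u, f (r • u) ∂μ ≤ r ^ s * K ^ 2 * J := by
    rw [hJ, ← integral_const_mul]
    exact integral_mono hi (hJi.const_mul _) hbd
  have hfe : ∫ ξ, f ξ ∂μ = r ^ Module.finrank ℝ V * ∫ u, f (r • u) ∂μ := by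
    rw [hcomp, abs_of_pos (by positivity), smul_eq_mul, ← mul_assoc, mul_inv_cancel₀ hrd.ne',
      one_mul]
  have hpow : r ^ Module.finrank ℝ V * r ^ s = t ^ (-((s + Module.finrank ℝ V) / b)) := by
    rw [← Real.rpow_natCast, ← Real.rpow_add hr0, hr, ← Real.rpow_mul ht0.le]
    congr 1
    field_simp
    ring
  calc ∫ ξ, f ξ ∂μ ≤ r ^ Module.finrank ℝ V * (r ^ s * K ^ 2 * J) := by
        rw [hfe]; gcongr
    _ = K ^ 2 * J * (r ^ Module.finrank ℝ V * r ^ s) := by ring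
    _ ≤ (K ^ 2 * J + 1) * (r ^ Module.finrank ℝ V * r ^ s) := by gcongr; linarith
    _ = _ := by rw [hpow]

end StretchedExponential

/-! ### Uniform bounds on densities through the characteristic function -/

section FourierBounds

open scoped RealInnerProductSpace

variable {Ω : Type*} [MeasurableSpace Ω] {n : ℕ} {P : Measure Ω} [IsProbabilityMeasure P]
  {X : ℝ≥0 → Ω → EuclideanSpace ℝ (Fin n)} {Ψ : EuclideanSpace ℝ (Fin n) → ℂ}

theorem IsCharExponent.norm_charFun_eq {P : Measure Ω} (hΨ : IsCharExponent P X Ψ) (t : ℝ≥0)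
    (ξ : EuclideanSpace ℝ (Fin n)) :
    ‖charFun (P.map (X t)) ξ‖ = Real.exp (-t * (Ψ ξ).re) := by
  rw [hΨ.charFun_eq, Complex.norm_exp]
  simp

/-- The lower bound on `Re Ψ` dominates the integrand by a stretched exponential. The range `s ≤ 2`
covers the weights `θ` (space) and `2θ` (time) with a single constant. -/
theorem exists_integral_one_add_norm_rpow_mul_norm_charFun_le (hn : 1 ≤ n)
    (hX : IsLevyProcess P X) (hΨ : IsCharExponent P X Ψ) {β κ T : ℝ} (hβ : 0 < β)
    (hinf : lowerIndexAtInfinity Ψ = (β : EReal)) (hκ : 0 < κ) (hT : 1 ≤ T) :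
    ∃ C : ℝ, 0 < C ∧ ∀ s ∈ Set.Icc (0 : ℝ) 2, ∀ t : ℝ≥0, 0 < t → (t : ℝ) ≤ T →
      Integrable (fun ξ : EuclideanSpace ℝ (Fin n) =>
        (1 + ‖ξ‖) ^ s * ‖charFun (P.map (X t)) (-(2 * Real.pi) • ξ)‖) ∧
      ∫ ξ, (1 + ‖ξ‖) ^ s * ‖charFun (P.map (X t)) (-(2 * Real.pi) • ξ)‖ ≤
        C / (t : ℝ) ^ ((s + n) / β + κ) := by
  have : Nontrivial (EuclideanSpace ℝ (Fin n)) := by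
    have : Nonempty (Fin n) := ⟨⟨0, hn⟩⟩
    infer_instance
  -- With `1/b = 1/β + κ/(n+2)`, the exponent `(s+n)/b` exceeds `(s+n)/β` by `(s+n)κ/(n+2)`, which
  -- is at most `κ` for every `s ≤ 2`.
  set b : ℝ := (β⁻¹ + κ / (n + 2))⁻¹ with hb
  have hκn : 0 < κ / ((n : ℝ) + 2) := by positivity
  have hb0 : 0 < b := by positivity
  have hbβ : b < β := by
    rw [hb, inv_lt_comm₀ (by positivity) hβ]; linarith
  obtain ⟨c, hc0, hc⟩ := exists_rpow_sub_le_re_of_lt_lowerIndex (Ψ := Ψ) hb0 (hΨ.re_nonneg hX)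
    (by rw [hinf]; exact_mod_cast hbβ)
  obtain ⟨C, hC0, hC⟩ := exists_integral_one_add_norm_rpow_mul_exp_le
    (volume : Measure (EuclideanSpace ℝ (Fin n))) hb0 hT
  refine ⟨Real.exp (T * c) * C * T ^ κ, by positivity, fun s hs t ht htT => ?_⟩
  have ht0 : (0 : ℝ) < t := ht
  obtain ⟨hi, hle⟩ := hC s hs t ⟨ht0, htT⟩
  have hbd : ∀ ξ : EuclideanSpace ℝ (Fin n),
      (1 + ‖ξ‖) ^ s * ‖charFun (P.map (X t)) (-(2 * Real.pi) • ξ)‖ ≤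
        Real.exp (T * c) * ((1 + ‖ξ‖) ^ s * Real.exp (-t * ‖ξ‖ ^ b)) := fun ξ => by
    rw [hΨ.norm_charFun_eq]
    have h1 : ‖ξ‖ ≤ ‖-(2 * Real.pi) • ξ‖ := by
      rw [norm_smul, norm_neg, Real.norm_of_nonneg (by positivity)]
      nlinarith [norm_nonneg ξ, Real.pi_gt_three]
    have h2 : ‖ξ‖ ^ b ≤ ‖-(2 * Real.pi) • ξ‖ ^ b := by gcongr
    have h3 := hc (-(2 * Real.pi) • ξ)
    have h4 : -(t : ℝ) * (Ψ (-(2 * Real.pi) • ξ)).re ≤ T * c + -t * ‖ξ‖ ^ b := by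
      have h5 : (t : ℝ) * (‖ξ‖ ^ b - c) ≤ t * (Ψ (-(2 * Real.pi) • ξ)).re := by
        gcongr; linarith
      have h6 : (t : ℝ) * c ≤ T * c := by gcongr
      linarith
    calc _ ≤ (1 + ‖ξ‖) ^ s * Real.exp (T * c + -t * ‖ξ‖ ^ b) := by gcongr
      _ = _ := by rw [Real.exp_add]; ring
  have hi' : Integrable (fun ξ : EuclideanSpace ℝ (Fin n) =>
        (1 + ‖ξ‖) ^ s * ‖charFun (P.map (X t)) (-(2 * Real.pi) • ξ)‖) := by
    refine (hi.const_mul (Real.exp (T * c))).mono' ?_ (.of_forall fun ξ => ?_)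
    · have := hX.isProbabilityMeasure_map t
      have hm := (measurable_charFun (μ := P.map (X t)))
      fun_prop
    · rw [Real.norm_of_nonneg (by positivity)]; exact hbd ξ
  refine ⟨hi', ?_⟩
  -- The unused part of `κ`: it lies in `[0, κ]`, so `t^e ≤ T^κ` because `T ≥ 1`.
  set e : ℝ := κ - (s + n) * (κ / (n + 2)) with he
  have he0 : 0 ≤ e := by
    have : (s + n) * (κ / (n + 2)) ≤ (2 + n) * (κ / (n + 2)) := by gcongr; exact hs.2
    have h2 : (2 + (n : ℝ)) * (κ / (n + 2)) = κ := by field_simp; ring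
    linarith
  have heκ : e ≤ κ := by
    have : 0 ≤ (s + n) * (κ / (n + 2)) := by have := hs.1; positivity
    linarith
  have hexp : (t : ℝ) ^ (-((s + n) / b)) ≤ T ^ κ / (t : ℝ) ^ ((s + n) / β + κ) := by
    have h1 : -((s + n) / b) = e + -((s + n) / β + κ) := by
      rw [hb, he, div_inv_eq_mul]; field_simp; ring
    rw [h1, Real.rpow_add ht0, Real.rpow_neg ht0.le, ← div_eq_mul_inv]
    gcongr
    calc (t : ℝ) ^ e ≤ T ^ e := Real.rpow_le_rpow ht0.le htT he0
      _ ≤ T ^ κ := Real.rpow_le_rpow_of_exponent_le hT heκ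
  calc _ ≤ ∫ ξ : EuclideanSpace ℝ (Fin n),
        Real.exp (T * c) * ((1 + ‖ξ‖) ^ s * Real.exp (-t * ‖ξ‖ ^ b)) :=
          integral_mono hi' (hi.const_mul _) hbd
    _ ≤ Real.exp (T * c) * (C * (t : ℝ) ^ (-((s + n) / b))) := by
        rw [integral_const_mul]
        gcongr
        simpa using hle
    _ ≤ Real.exp (T * c) * (C * (T ^ κ / (t : ℝ) ^ ((s + n) / β + κ))) := by gcongr
    _ = _ := by ring

theorem integrable_charFun_of_lowerIndex (hn : 1 ≤ n) (hX : IsLevyProcess P X)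
    (hΨ : IsCharExponent P X Ψ) {β : ℝ} (hβ : 0 < β)
    (hinf : lowerIndexAtInfinity Ψ = (β : EReal)) {t : ℝ≥0} (ht : 0 < t) :
    Integrable (charFun (P.map (X t))) := by
  obtain ⟨C, -, hC⟩ := exists_integral_one_add_norm_rpow_mul_norm_charFun_le hn hX hΨ hβ hinf
    one_pos (le_max_right (t : ℝ) 1)
  have h := (hC 0 (by simp) t ht (le_max_left _ _)).1
  have := hX.isProbabilityMeasure_map t
  simp only [Real.rpow_zero, one_mul] at h
  have hm : Measurable (charFun (P.map (X t))) := measurable_charFun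
  rw [integrable_norm_iff (by fun_prop),
    integrable_comp_smul_iff volume _ (by simp [Real.pi_ne_zero])] at h
  exact h

/-- Interpolates the trivial bound 2 on a difference of exponentials with the Lipschitz bound `x`,
producing Hölder exponents. -/
theorem le_two_mul_rpow_of_le_two {x y θ : ℝ} (hx : 0 ≤ x) (hy2 : y ≤ 2) (hyx : y ≤ x)
    (hθ : θ ∈ Set.Ioo (0 : ℝ) 1) : y ≤ 2 * x ^ θ := by
  rcases le_total x 1 with h | h
  · have : x ^ (1 : ℝ) ≤ x ^ θ := Real.rpow_le_rpow_of_exponent_ge' hx h hθ.1.le hθ.2.le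
    rw [Real.rpow_one] at this
    linarith
  · linarith [Real.one_le_rpow h hθ.1.le]

theorem MeasureTheory.Integrable.exp_inner_smul {V : Type*} [NormedAddCommGroup V]
    [InnerProductSpace ℝ V] [MeasurableSpace V] [BorelSpace V] [SecondCountableTopology V]
    {μ : Measure V} {m : V → ℂ} (hm : Integrable m μ) (w : V) :
    Integrable (fun v => Complex.exp ((2 * Real.pi * ⟪v, w⟫ : ℝ) * Complex.I) • m v) μ := by
  have hc : Continuous fun v : V => Complex.exp ((2 * Real.pi * ⟪v, w⟫ : ℝ) * Complex.I) := by
    fun_prop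
  refine hm.norm.mono' (hc.aestronglyMeasurable.smul hm.aestronglyMeasurable)
    (.of_forall fun v => ?_)
  rw [norm_smul, Complex.norm_exp_ofReal_mul_I, one_mul]

/-- Hölder continuity in space of the inverse Fourier transform of a Lévy semigroup. -/
theorem exists_norm_charFunInv_add_sub_le (hn : 1 ≤ n)
    (hX : IsLevyProcess P X) (hΨ : IsCharExponent P X Ψ) {β κ T : ℝ} (hβ : 0 < β)
    (hinf : lowerIndexAtInfinity Ψ = (β : EReal)) (hκ : 0 < κ) (hT : 1 ≤ T) :
    ∃ C : ℝ, 0 < C ∧ ∀ θ ∈ Set.Ioo (0 : ℝ) 1, ∀ t : ℝ≥0, 0 < t → (t : ℝ) ≤ T →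
      ∀ h x : EuclideanSpace ℝ (Fin n),
        ‖charFunInv (charFun (P.map (X t))) (x + h) - charFunInv (charFun (P.map (X t))) x‖ ≤
          C * (‖h‖ ^ θ / (t : ℝ) ^ ((θ + n) / β + κ)) := by
  obtain ⟨C, hC0, hC⟩ :=
    exists_integral_one_add_norm_rpow_mul_norm_charFun_le hn hX hΨ hβ hinf hκ hT
  refine ⟨2 * (2 * Real.pi) * C, by positivity, fun θ hθ t ht htT h x => ?_⟩
  obtain ⟨hi, hle⟩ := hC θ ⟨hθ.1.le, by linarith [hθ.2]⟩ t ht htT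
  have hm := integrable_comp_neg_two_pi_smul
    (integrable_charFun_of_lowerIndex hn hX hΨ hβ hinf ht)
  set m := fun ξ : EuclideanSpace ℝ (Fin n) => charFun (P.map (X t)) (-(2 * Real.pi) • ξ)
  have hsub : charFunInv (charFun (P.map (X t))) (x + h) - charFunInv (charFun (P.map (X t))) x =
      ∫ v, (Complex.exp ((2 * Real.pi * ⟪v, x + h⟫ : ℝ) * Complex.I) • m v -
        Complex.exp ((2 * Real.pi * ⟪v, x⟫ : ℝ) * Complex.I) • m v) := by
    rw [integral_sub (hm.exp_inner_smul _) (hm.exp_inner_smul _), charFunInv,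
      Real.fourierInv_eq', Real.fourierInv_eq']
  have hbd : ∀ v : EuclideanSpace ℝ (Fin n),
      ‖Complex.exp ((2 * Real.pi * ⟪v, x + h⟫ : ℝ) * Complex.I) • m v -
        Complex.exp ((2 * Real.pi * ⟪v, x⟫ : ℝ) * Complex.I) • m v‖ ≤
      2 * (2 * Real.pi) * ‖h‖ ^ θ * ((1 + ‖v‖) ^ θ * ‖m v‖) := fun v => by
    have e1 : Complex.exp ((2 * Real.pi * ⟪v, x + h⟫ : ℝ) * Complex.I) • m v -
        Complex.exp ((2 * Real.pi * ⟪v, x⟫ : ℝ) * Complex.I) • m v =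
        Complex.exp ((2 * Real.pi * ⟪v, x⟫ : ℝ) * Complex.I) *
          (Complex.exp (Complex.I * (2 * Real.pi * ⟪v, h⟫ : ℝ)) - 1) * m v := by
      rw [inner_add_right, mul_add, Complex.ofReal_add, add_mul, Complex.exp_add,
        mul_comm Complex.I]
      simp only [smul_eq_mul]; ring
    rw [e1, norm_mul, norm_mul, Complex.norm_exp_ofReal_mul_I, one_mul]
    have e2 : ‖Complex.exp (Complex.I * (2 * Real.pi * ⟪v, h⟫ : ℝ)) - 1‖ ≤ 2 := by
      refine (norm_sub_le _ _).trans ?_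
      rw [mul_comm Complex.I, Complex.norm_exp_ofReal_mul_I]; norm_num
    have e3 : ‖Complex.exp (Complex.I * (2 * Real.pi * ⟪v, h⟫ : ℝ)) - 1‖ ≤
        2 * Real.pi * (‖h‖ * (1 + ‖v‖)) := by
      refine (Real.norm_exp_I_mul_ofReal_sub_one_le).trans ?_
      rw [norm_mul, Real.norm_of_nonneg (by positivity : 0 ≤ 2 * Real.pi)]
      have := norm_inner_le_norm (𝕜 := ℝ) v h
      gcongr
      nlinarith [norm_nonneg h]
    have e4 := le_two_mul_rpow_of_le_two (by positivity) e2 e3 hθ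
    have e5 : (2 * Real.pi * (‖h‖ * (1 + ‖v‖))) ^ θ ≤
        2 * Real.pi * (‖h‖ ^ θ * (1 + ‖v‖) ^ θ) := by
      rw [Real.mul_rpow (x := 2 * Real.pi) (by positivity) (by positivity),
        Real.mul_rpow (x := ‖h‖) (by positivity) (by positivity)]
      refine mul_le_mul_of_nonneg_right ?_ (by positivity)
      calc (2 * Real.pi) ^ θ ≤ (2 * Real.pi) ^ (1 : ℝ) :=
            Real.rpow_le_rpow_of_exponent_le (by linarith [Real.pi_gt_three]) hθ.2.le
        _ = 2 * Real.pi := Real.rpow_one _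
    calc _ ≤ (2 * (2 * Real.pi * (‖h‖ ^ θ * (1 + ‖v‖) ^ θ))) * ‖m v‖ := by
          gcongr; linarith
      _ = _ := by ring
  rw [hsub]
  calc _ ≤ ∫ v, 2 * (2 * Real.pi) * ‖h‖ ^ θ * ((1 + ‖v‖) ^ θ * ‖m v‖) :=
        norm_integral_le_of_norm_le (hi.const_mul _) (.of_forall hbd)
    _ ≤ 2 * (2 * Real.pi) * ‖h‖ ^ θ * (C / (t : ℝ) ^ ((θ + n) / β + κ)) := by
        rw [integral_const_mul]; gcongr
    _ = _ := by ring

/-- Hölder continuity in time of the inverse Fourier transform of a Lévy semigroup. -/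
theorem exists_norm_charFunInv_time_sub_le (hn : 1 ≤ n)
    (hX : IsLevyProcess P X) (hΨ : IsCharExponent P X Ψ) {β κ T : ℝ} (hβ : 0 < β)
    (hinf : lowerIndexAtInfinity Ψ = (β : EReal)) (hκ : 0 < κ) (hT : 1 ≤ T) :
    ∃ C : ℝ, 0 < C ∧ ∀ θ ∈ Set.Ioo (0 : ℝ) 1, ∀ t : ℝ≥0, 0 < t → (t : ℝ) ≤ T →
      ∀ (ε : ℝ≥0) (x : EuclideanSpace ℝ (Fin n)),
        ‖charFunInv (charFun (P.map (X (t + ε)))) x - charFunInv (charFun (P.map (X t))) x‖ ≤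
          C * ((ε : ℝ) ^ θ / (t : ℝ) ^ ((2 * θ + n) / β + κ)) := by
  obtain ⟨C, hC0, hC⟩ :=
    exists_integral_one_add_norm_rpow_mul_norm_charFun_le hn hX hΨ hβ hinf hκ hT
  obtain ⟨M, hM1, hM⟩ := hΨ.exists_norm_le hX
  set K : ℝ := M * (2 * Real.pi) ^ 2 with hK
  have hK1 : 1 ≤ K := by
    have : (1 : ℝ) ≤ (2 * Real.pi) ^ 2 := one_le_pow₀ (by linarith [Real.pi_gt_three])
    exact one_le_mul_of_one_le_of_one_le hM1 this
  refine ⟨2 * K * C, by positivity, fun θ hθ t ht htT ε x => ?_⟩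
  -- Quadratic growth of `Ψ` raised to the power `θ` gives the weight `(1+‖ξ‖)^{2θ}`.
  obtain ⟨hi, hle⟩ := hC (2 * θ) ⟨by linarith [hθ.1], by linarith [hθ.2]⟩ t ht htT
  have hm : ∀ t : ℝ≥0, 0 < t → Integrable fun ξ : EuclideanSpace ℝ (Fin n) =>
      charFun (P.map (X t)) (-(2 * Real.pi) • ξ) := fun t ht => integrable_comp_neg_two_pi_smul
    (integrable_charFun_of_lowerIndex hn hX hΨ hβ hinf ht)
  set m := fun (t : ℝ≥0) (ξ : EuclideanSpace ℝ (Fin n)) =>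
    charFun (P.map (X t)) (-(2 * Real.pi) • ξ) with hmdef
  have hsub : charFunInv (charFun (P.map (X (t + ε)))) x - charFunInv (charFun (P.map (X t))) x =
      ∫ v, (Complex.exp ((2 * Real.pi * ⟪v, x⟫ : ℝ) * Complex.I) • m (t + ε) v -
        Complex.exp ((2 * Real.pi * ⟪v, x⟫ : ℝ) * Complex.I) • m t v) := by
    rw [integral_sub ((hm _ (by positivity)).exp_inner_smul _) ((hm _ ht).exp_inner_smul _),
      charFunInv, charFunInv, Real.fourierInv_eq', Real.fourierInv_eq']
  have hbd : ∀ v : EuclideanSpace ℝ (Fin n),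
      ‖Complex.exp ((2 * Real.pi * ⟪v, x⟫ : ℝ) * Complex.I) • m (t + ε) v -
        Complex.exp ((2 * Real.pi * ⟪v, x⟫ : ℝ) * Complex.I) • m t v‖ ≤
      2 * K * (ε : ℝ) ^ θ * ((1 + ‖v‖) ^ (2 * θ) * ‖m t v‖) := fun v => by
    set z := Ψ (-(2 * Real.pi) • v) with hz
    have hz0 : 0 ≤ z.re := hΨ.re_nonneg hX _
    have hre : 0 ≤ ((ε : ℝ) * z : ℂ).re := by
      rw [Complex.re_ofReal_mul]; positivity
    have e1 : m (t + ε) v = m t v * Complex.exp (-((ε : ℝ) * z)) := by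
      simp only [hmdef, hΨ.charFun_eq, ← Complex.exp_add, ← hz]
      push_cast; ring_nf
    rw [e1, ← smul_sub, norm_smul, Complex.norm_exp_ofReal_mul_I, one_mul, ← norm_neg,
      show -(m t v * Complex.exp (-((ε : ℝ) * z)) - m t v) =
        (1 - Complex.exp (-((ε : ℝ) * z))) * m t v by ring, norm_mul]
    have e2 : ‖1 - Complex.exp (-((ε : ℝ) * z))‖ ≤ 2 := by
      refine (norm_sub_le _ _).trans ?_
      rw [Complex.norm_exp, norm_one, Complex.neg_re]
      linarith [Real.exp_le_one_iff.2 (neg_nonpos.2 hre)]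
    have e3 : ‖1 - Complex.exp (-((ε : ℝ) * z))‖ ≤ K * (ε * (1 + ‖v‖) ^ 2) := by
      refine (norm_one_sub_exp_neg_le hre).trans ?_
      rw [norm_mul, Complex.norm_real, Real.norm_of_nonneg ε.coe_nonneg]
      have h1 : ‖z‖ ≤ M * (2 * Real.pi * (1 + ‖v‖)) ^ 2 := by
        refine (hM _).trans ?_
        rw [norm_smul, norm_neg, Real.norm_of_nonneg (by positivity : 0 ≤ 2 * Real.pi)]
        gcongr
        nlinarith [Real.pi_gt_three, norm_nonneg v]
      calc (ε : ℝ) * ‖z‖ ≤ ε * (M * (2 * Real.pi * (1 + ‖v‖)) ^ 2) := by gcongr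
        _ = _ := by rw [hK]; ring
    have e4 := le_two_mul_rpow_of_le_two (by positivity) e2 e3 hθ
    have e5 : (K * (ε * (1 + ‖v‖) ^ 2)) ^ θ ≤ K * ((ε : ℝ) ^ θ * (1 + ‖v‖) ^ (2 * θ)) := by
      rw [Real.mul_rpow (x := K) (by positivity) (by positivity),
        Real.mul_rpow (x := (ε : ℝ)) (by positivity) (by positivity), Real.rpow_mul (by positivity),
        Real.rpow_two]
      refine mul_le_mul_of_nonneg_right ?_ (by positivity)
      calc K ^ θ ≤ K ^ (1 : ℝ) := Real.rpow_le_rpow_of_exponent_le hK1 hθ.2.le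
        _ = K := Real.rpow_one _
    calc _ ≤ (2 * (K * ((ε : ℝ) ^ θ * (1 + ‖v‖) ^ (2 * θ)))) * ‖m t v‖ := by
          gcongr; linarith
      _ = _ := by ring
  rw [hsub]
  calc _ ≤ ∫ v, 2 * K * (ε : ℝ) ^ θ * ((1 + ‖v‖) ^ (2 * θ) * ‖m t v‖) :=
        norm_integral_le_of_norm_le (hi.const_mul _) (.of_forall hbd)
    _ ≤ 2 * K * (ε : ℝ) ^ θ * (C / (t : ℝ) ^ ((2 * θ + n) / β + κ)) := by
        rw [integral_const_mul]; gcongr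
    _ = _ := by ring

end FourierBounds

/-! ### Truncation inequality -/

section Tail

open scoped RealInnerProductSpace

variable {V : Type*} [NormedAddCommGroup V] [InnerProductSpace ℝ V] [FiniteDimensional ℝ V]
  [MeasurableSpace V] [BorelSpace V]

theorem setIntegral_le_setIntegral_comp_add_right {f : V → ℝ} (hf0 : ∀ x, 0 ≤ f x) {s t : Set V}
    (hf : IntegrableOn f t) (v : V) (hst : ∀ x ∈ s, x + v ∈ t) :
    ∫ x in s, f (x + v) ≤ ∫ x in t, f x := by
  have hmp := measurePreserving_add_right (volume : Measure V) v
  have hme := (Homeomorph.addRight v).measurableEmbedding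
  rw [← hmp.setIntegral_preimage_emb hme f t]
  refine setIntegral_mono_set ?_ (.of_forall fun x => hf0 _)
    (LE.le.eventuallyLE hst)
  exact (hmp.integrableOn_comp_preimage hme).2 hf

/-- Translation by `v = πx/‖x‖²` moves `⟪x, ξ⟫` by half a period, so the integrand at `ξ` and at `ξ
+ v` adds up to 2. As `‖v‖ = π/‖x‖ ≤ ρ/2`, the half ball and its translate both lie in the ball of
radius `ρ`. -/
theorem volume_closedBall_half_le_integral_one_sub_cos {ρ : ℝ} (hρ : 0 < ρ) {x : V}
    (hx : 2 * Real.pi / ρ ≤ ‖x‖) :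
    volume.real (Metric.closedBall (0 : V) (ρ / 2)) ≤
      ∫ ξ in Metric.closedBall (0 : V) ρ, (1 - Real.cos ⟪x, ξ⟫) := by
  have hx0 : 0 < ‖x‖ := lt_of_lt_of_le (by positivity) hx
  set f : V → ℝ := fun ξ => 1 - Real.cos ⟪x, ξ⟫ with hf
  have hfc : Continuous f := by fun_prop
  have hf0 : ∀ ξ, 0 ≤ f ξ := fun ξ => sub_nonneg.2 (Real.cos_le_one _)
  have hfi : ∀ r, IntegrableOn f (Metric.closedBall (0 : V) r) := fun r =>
    hfc.continuousOn.integrableOn_compact (isCompact_closedBall _ _)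
  set v : V := (Real.pi / ‖x‖ ^ 2) • x with hv
  have hvn : ‖v‖ ≤ ρ / 2 := by
    rw [hv, norm_smul, Real.norm_of_nonneg (by positivity)]
    rw [div_le_iff₀ hρ] at hx
    have : Real.pi / ‖x‖ ^ 2 * ‖x‖ = Real.pi / ‖x‖ := by field_simp
    rw [this, div_le_iff₀ hx0]
    linarith
  have hsum : ∀ ξ, f ξ + f (ξ + v) = 2 := fun ξ => by
    have : ⟪x, ξ + v⟫ = ⟪x, ξ⟫ + Real.pi := by
      rw [inner_add_right, hv, inner_smul_right, real_inner_self_eq_norm_sq]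
      field_simp
    simp only [hf, this, Real.cos_add_pi]
    ring
  have h1 := setIntegral_le_setIntegral_comp_add_right hf0 (s := Metric.closedBall (0 : V) (ρ / 2))
    (hfi ρ) 0 (fun y hy => by
      simp only [Metric.mem_closedBall, dist_zero_right, add_zero] at hy ⊢; linarith)
  have h2 := setIntegral_le_setIntegral_comp_add_right hf0 (s := Metric.closedBall (0 : V) (ρ / 2))
    (hfi ρ) v (fun y hy => by
      simp only [Metric.mem_closedBall, dist_zero_right] at hy ⊢
      linarith [norm_add_le y v])
  have h3 : ∫ ξ in Metric.closedBall (0 : V) (ρ / 2), (f ξ + f (ξ + v)) =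
      2 * volume.real (Metric.closedBall (0 : V) (ρ / 2)) := by
    simp_rw [hsum]
    simp [mul_comm]
  rw [integral_add (hfi _) (g := fun ξ => f (ξ + v))
    ((hfc.comp (continuous_add_const v)).continuousOn.integrableOn_compact
    (isCompact_closedBall _ _))] at h3
  simp only [add_zero] at h1
  linarith

/-- Tail of a probability measure in terms of its characteristic function near the origin. -/
theorem measureReal_le_norm_mul_le_integral_charFun (μ : Measure V) [IsProbabilityMeasure μ]
    {ρ : ℝ} (hρ : 0 < ρ) :
    μ.real {x | 2 * Real.pi / ρ ≤ ‖x‖} * volume.real (Metric.closedBall (0 : V) (ρ / 2)) ≤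
      ∫ ξ in Metric.closedBall (0 : V) ρ, (1 - (charFun μ ξ).re) := by
  have : IsFiniteMeasure ((volume : Measure V).restrict (Metric.closedBall (0 : V) ρ)) :=
    ⟨by simpa using measure_closedBall_lt_top⟩
  have hprod : Integrable (Function.uncurry fun (x ξ : V) => 1 - Real.cos ⟪x, ξ⟫)
      (μ.prod (volume.restrict (Metric.closedBall (0 : V) ρ))) := by
    have hc : Continuous (Function.uncurry fun (x ξ : V) => 1 - Real.cos ⟪x, ξ⟫) := by
      unfold Function.uncurry; fun_prop
    refine Integrable.of_bound hc.aestronglyMeasurable 2 (.of_forall fun p => ?_)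
    simp only [Function.uncurry]
    rw [Real.norm_eq_abs, abs_le]
    constructor <;> linarith [Real.cos_le_one ⟪p.1, p.2⟫, Real.neg_one_le_cos ⟪p.1, p.2⟫]
  have hre : ∀ ξ : V, 1 - (charFun μ ξ).re = ∫ x, (1 - Real.cos ⟪x, ξ⟫) ∂μ := fun ξ => by
    have hc : Continuous fun x : V => Complex.exp (⟪x, ξ⟫ * Complex.I) := by fun_prop
    have hi : Integrable (fun x : V => Complex.exp (⟪x, ξ⟫ * Complex.I)) μ :=
      Integrable.of_bound hc.aestronglyMeasurable 1
        (.of_forall fun x => (Complex.norm_exp_ofReal_mul_I _).le)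
    have hcos : ∀ x : V, Real.cos ⟪x, ξ⟫ = (Complex.exp (⟪x, ξ⟫ * Complex.I)).re := fun x =>
      (Complex.exp_ofReal_mul_I_re _).symm
    have h1 : ∫ x, Real.cos ⟪x, ξ⟫ ∂μ = (charFun μ ξ).re := by
      simp_rw [hcos, charFun_apply]
      exact integral_re (𝕜 := ℂ) hi
    have h2 : Integrable (fun x : V => Real.cos ⟪x, ξ⟫) μ := by
      simp_rw [hcos]; exact hi.re
    rw [integral_sub (integrable_const _) h2, h1]
    simp
  have hS : MeasurableSet {x : V | 2 * Real.pi / ρ ≤ ‖x‖} :=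
    measurableSet_le measurable_const measurable_norm
  have h0 : ∀ x : V, 0 ≤ ∫ ξ in Metric.closedBall (0 : V) ρ, (1 - Real.cos ⟪x, ξ⟫) := fun x =>
    integral_nonneg fun ξ => sub_nonneg.2 (Real.cos_le_one _)
  simp_rw [hre]
  -- After Fubini, the inner integral is at least the volume of the half ball on the tail set and
  -- nonnegative elsewhere.
  rw [integral_integral_swap (f := fun ξ x : V => 1 - Real.cos ⟪x, ξ⟫) hprod.swap]
  calc _ = ∫ x in {x : V | 2 * Real.pi / ρ ≤ ‖x‖},
        volume.real (Metric.closedBall (0 : V) (ρ / 2)) ∂μ := by simp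
    _ ≤ ∫ x in {x : V | 2 * Real.pi / ρ ≤ ‖x‖},
        (∫ ξ in Metric.closedBall (0 : V) ρ, (1 - Real.cos ⟪x, ξ⟫)) ∂μ :=
        setIntegral_mono_on (integrable_const _).integrableOn hprod.integral_prod_left.integrableOn
          hS fun x hx => volume_closedBall_half_le_integral_one_sub_cos hρ hx
    _ ≤ _ := setIntegral_le_integral hprod.integral_prod_left (.of_forall h0)

end Tail

/-! ### Polynomial tails of the process -/

section LevyTail

variable {Ω : Type*} [MeasurableSpace Ω] {n : ℕ} {P : Measure Ω} [IsProbabilityMeasure P]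
  {X : ℝ≥0 → Ω → EuclideanSpace ℝ (Fin n)} {Ψ : EuclideanSpace ℝ (Fin n) → ℂ}

/-- Put `ρ = 2π/R`. If `ρ ≤ 1`, then on the ball of radius `ρ` one has `1 - Re φ_t ≤ t‖Ψ‖ ≤ T
ρ^{n+β₀} ‖Ψ‖/‖ξ‖^{n+β₀}`, and division by the volume, of order `ρ^n`, leaves `ρ^{β₀}`. If `ρ ≥ 1`, a
probability is at most 1. -/
theorem exists_measureReal_le_norm_le (hX : IsLevyProcess P X) (hΨ : IsCharExponent P X Ψ)
    {β₀ T : ℝ} (hβ₀ : 0 < β₀) (hT : 0 ≤ T)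
    (hzero : IntegrableOn (fun ξ => ‖Ψ ξ‖ / ‖ξ‖ ^ ((n : ℝ) + β₀))
      (Metric.closedBall (0 : EuclideanSpace ℝ (Fin n)) 1)) :
    ∃ C : ℝ, 0 < C ∧ ∀ t : ℝ≥0, (t : ℝ) ≤ T → ∀ R : ℝ, 0 < R →
      (P.map (X t)).real {x | R ≤ ‖x‖} ≤ C * R ^ (-β₀) := by
  set K := ∫ ξ in Metric.closedBall (0 : EuclideanSpace ℝ (Fin n)) 1,
    ‖Ψ ξ‖ / ‖ξ‖ ^ ((n : ℝ) + β₀) with hK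
  have hK0 : 0 ≤ K := integral_nonneg fun ξ => by positivity
  set v := volume.real (Metric.closedBall (0 : EuclideanSpace ℝ (Fin n)) 1) with hv
  have hv0 : 0 < v :=
    ENNReal.toReal_pos (Metric.measure_closedBall_pos volume _ one_pos).ne'
      measure_closedBall_lt_top.ne
  set D := T * K * 2 ^ n / v with hD
  have hD0 : 0 ≤ D := by positivity
  have hpi : (0 : ℝ) < 2 * Real.pi := by positivity
  refine ⟨(D + 1) * (2 * Real.pi) ^ β₀, by positivity, fun t htT R hR => ?_⟩
  have := hX.isProbabilityMeasure_map t
  have hRe : (2 * Real.pi) ^ β₀ * R ^ (-β₀) = (2 * Real.pi / R) ^ β₀ := by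
    rw [Real.div_rpow hpi.le hR.le, Real.rpow_neg hR.le, div_eq_mul_inv]
  rw [mul_assoc, hRe]
  set ρ := 2 * Real.pi / R with hρ
  have hρ0 : 0 < ρ := by positivity
  have hRρ : R = 2 * Real.pi / ρ := by rw [hρ]; field_simp
  rcases le_total 1 ρ with h1 | h1
  · calc (P.map (X t)).real {x | R ≤ ‖x‖} ≤ 1 := measureReal_le_one
      _ ≤ 1 * ρ ^ β₀ := by rw [one_mul]; exact Real.one_le_rpow h1 hβ₀.le
      _ ≤ (D + 1) * ρ ^ β₀ := by gcongr; linarith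
  have htail := measureReal_le_norm_mul_le_integral_charFun (P.map (X t)) hρ0
  rw [← hRρ] at htail
  have hsub : Metric.closedBall (0 : EuclideanSpace ℝ (Fin n)) ρ ⊆ Metric.closedBall 0 1 :=
    Metric.closedBall_subset_closedBall h1
  have hpt : ∀ ξ ∈ Metric.closedBall (0 : EuclideanSpace ℝ (Fin n)) ρ,
      1 - (charFun (P.map (X t)) ξ).re ≤
        T * ρ ^ ((n : ℝ) + β₀) * (‖Ψ ξ‖ / ‖ξ‖ ^ ((n : ℝ) + β₀)) := fun ξ hξ => by
    have hξ' : ‖ξ‖ ≤ ρ := by simpa using hξ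
    have e1 : 1 - (charFun (P.map (X t)) ξ).re ≤ t * ‖Ψ ξ‖ := by
      have hre : 0 ≤ (((t : ℝ) : ℂ) * Ψ ξ).re := by
        rw [Complex.re_ofReal_mul]; exact mul_nonneg t.coe_nonneg (hΨ.re_nonneg hX ξ)
      calc 1 - (charFun (P.map (X t)) ξ).re = (1 - charFun (P.map (X t)) ξ).re := by simp
        _ ≤ ‖1 - charFun (P.map (X t)) ξ‖ := Complex.re_le_norm _
        _ ≤ ‖((t : ℝ) : ℂ) * Ψ ξ‖ := by
            rw [hΨ.charFun_eq, neg_mul]; exact norm_one_sub_exp_neg_le hre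
        _ = t * ‖Ψ ξ‖ := by simp
    have e2 : ‖Ψ ξ‖ ≤ ρ ^ ((n : ℝ) + β₀) * (‖Ψ ξ‖ / ‖ξ‖ ^ ((n : ℝ) + β₀)) := by
      -- At the origin the quotient is 0 by the convention on division, so `Ψ 0 = 0` is needed.
      rcases eq_or_ne ξ 0 with rfl | hne
      · simp [hΨ.map_zero hX]
      · have hpos : 0 < ‖ξ‖ ^ ((n : ℝ) + β₀) := Real.rpow_pos_of_pos (norm_pos_iff.2 hne) _
        rw [mul_div_assoc', le_div_iff₀ hpos, mul_comm]
        gcongr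
    calc _ ≤ (t : ℝ) * ‖Ψ ξ‖ := e1
      _ ≤ T * (ρ ^ ((n : ℝ) + β₀) * (‖Ψ ξ‖ / ‖ξ‖ ^ ((n : ℝ) + β₀))) := by gcongr
      _ = _ := by ring
  have hcf : IntegrableOn (fun ξ => 1 - (charFun (P.map (X t)) ξ).re)
      (Metric.closedBall (0 : EuclideanSpace ℝ (Fin n)) ρ) := by
    refine Continuous.continuousOn ?_ |>.integrableOn_compact (isCompact_closedBall _ _)
    have := hΨ.continuous
    simp_rw [hΨ.charFun_eq]
    fun_prop
  have hle : ∫ ξ in Metric.closedBall (0 : EuclideanSpace ℝ (Fin n)) ρ,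
      (1 - (charFun (P.map (X t)) ξ).re) ≤ T * ρ ^ ((n : ℝ) + β₀) * K := by
    calc _ ≤ ∫ ξ in Metric.closedBall (0 : EuclideanSpace ℝ (Fin n)) ρ,
          T * ρ ^ ((n : ℝ) + β₀) * (‖Ψ ξ‖ / ‖ξ‖ ^ ((n : ℝ) + β₀)) :=
          setIntegral_mono_on hcf ((hzero.mono_set hsub).const_mul _)
            Metric.isClosed_closedBall.measurableSet hpt
      _ ≤ _ := by
          rw [integral_const_mul]
          gcongr
          exact setIntegral_mono_set hzero (.of_forall fun ξ => by positivity)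
            (LE.le.eventuallyLE hsub)
  have hvol : volume.real (Metric.closedBall (0 : EuclideanSpace ℝ (Fin n)) (ρ / 2)) =
      (ρ / 2) ^ n * v := by
    rw [Measure.addHaar_real_closedBall' _ _ (by positivity), finrank_euclideanSpace_fin]
  have hρn : 0 < (ρ / 2) ^ n * v := by positivity
  rw [hvol] at htail
  have hfin := (le_div_iff₀ hρn).2 (htail.trans hle)
  refine hfin.trans ?_
  have : T * ρ ^ ((n : ℝ) + β₀) * K / ((ρ / 2) ^ n * v) = D * ρ ^ β₀ := by
    rw [Real.rpow_add hρ0, Real.rpow_natCast, hD, div_pow ρ 2 n]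
    field_simp
  rw [this]
  gcongr
  linarith

end LevyTail

/-! ### Interpolation between uniform bound and tail -/

section Interpolation

/-- Interpolation between a uniform bound of size `A` and a polynomial tail. -/
theorem integral_abs_le_of_sup_le_of_tail_le {n : ℕ} {f : EuclideanSpace ℝ (Fin n) → ℝ}
    {A K β₀ s : ℝ} (hf : Integrable f) (hA : 0 < A) (hK : 0 ≤ K) (hβ₀ : 0 < β₀)
    (hs : s ∈ Set.Ioo (0 : ℝ) 1) (hsup : ∀ᵐ x, |f x| ≤ K * A)
    (htail : ∀ R, 2 ≤ R → ∫ x in {x | R ≤ ‖x‖}, |f x| ≤ K * R ^ (-β₀))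
    (htot : ∫ x, |f x| ≤ 2) :
    ∫ x, |f x| ≤
      (2 + (volume.real (Metric.ball (0 : EuclideanSpace ℝ (Fin n)) 1) * 2 ^ n + 1) * K) *
        A ^ (s * β₀ / (n + β₀)) := by
  set v := volume.real (Metric.ball (0 : EuclideanSpace ℝ (Fin n)) 1) with hv
  have hv0 : 0 ≤ v := measureReal_nonneg
  have hs0 : 0 < s := hs.1
  have hnβ : 0 < (n : ℝ) + β₀ := by positivity
  have hc0 : 0 ≤ (v * 2 ^ n + 1) * K := by positivity
  rcases le_total 1 A with h1 | h1
  · have : 1 ≤ A ^ (s * β₀ / (n + β₀)) := Real.one_le_rpow h1 (by positivity)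
    nlinarith
  -- The radius balancing `R^n A` against `R^{-β₀}`; the factor 2 guarantees `R ≥ 2`, the range
  -- where the tail bound is assumed.
  set R := 2 * A ^ (-(1 / (n + β₀))) with hR
  have hA1 : 1 ≤ A ^ (-(1 / (n + β₀))) :=
    Real.one_le_rpow_of_pos_of_le_one_of_nonpos hA h1 (neg_nonpos.2 (by positivity))
  have hR2 : 2 ≤ R := by linarith
  have hS : MeasurableSet {x : EuclideanSpace ℝ (Fin n) | R ≤ ‖x‖} :=
    measurableSet_le measurable_const measurable_norm
  have hcompl : {x : EuclideanSpace ℝ (Fin n) | R ≤ ‖x‖}ᶜ = Metric.ball 0 R := by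
    ext x; simp
  have hA' : A ^ (β₀ / (n + β₀)) ≤ A ^ (s * β₀ / (n + β₀)) := by
    apply Real.rpow_le_rpow_of_exponent_ge hA h1
    gcongr
    exact mul_le_of_le_one_left hβ₀.le hs.2.le
  have hin : ∫ x in Metric.ball (0 : EuclideanSpace ℝ (Fin n)) R, |f x| ≤
      v * 2 ^ n * K * A ^ (β₀ / (n + β₀)) := by
    have hfin : volume (Metric.ball (0 : EuclideanSpace ℝ (Fin n)) R) < ∞ := measure_ball_lt_top
    calc _ ≤ ∫ x in Metric.ball (0 : EuclideanSpace ℝ (Fin n)) R, K * A :=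
          setIntegral_mono_ae hf.abs.integrableOn (integrableOn_const hfin.ne) hsup
      _ = R ^ n * v * (K * A) := by
          rw [setIntegral_const, measureReal_def, Measure.addHaar_ball_of_pos _ _ (by positivity),
            finrank_euclideanSpace_fin, smul_eq_mul, ENNReal.toReal_mul,
            ENNReal.toReal_ofReal (by positivity), hv, measureReal_def]
      _ = v * 2 ^ n * K * (A ^ (-(1 / (n + β₀)) * n) * A ^ (1 : ℝ)) := by
          rw [hR, mul_pow, Real.rpow_mul hA.le, Real.rpow_natCast, Real.rpow_one]; ring
      _ = _ := by
          rw [← Real.rpow_add hA]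
          congr 2
          field_simp
          ring
  have hout : ∫ x in {x : EuclideanSpace ℝ (Fin n) | R ≤ ‖x‖}, |f x| ≤
      K * A ^ (β₀ / (n + β₀)) := by
    refine (htail R hR2).trans ?_
    gcongr
    calc R ^ (-β₀) ≤ (A ^ (-(1 / (n + β₀)))) ^ (-β₀) :=
          Real.rpow_le_rpow_of_nonpos (by positivity) (by linarith) (by linarith)
      _ = _ := by rw [← Real.rpow_mul hA.le]; congr 1; ring
  calc ∫ x, |f x| = (∫ x in {x : EuclideanSpace ℝ (Fin n) | R ≤ ‖x‖}, |f x|) +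
        ∫ x in Metric.ball (0 : EuclideanSpace ℝ (Fin n)) R, |f x| := by
        rw [← hcompl, integral_add_compl hS hf.abs]
    _ ≤ (v * 2 ^ n + 1) * K * A ^ (β₀ / (n + β₀)) := by linarith
    _ ≤ (v * 2 ^ n + 1) * K * A ^ (s * β₀ / (n + β₀)) := by gcongr
    _ ≤ _ := by gcongr; linarith

end Interpolation

/-! ### Elementary properties of transition densities -/

section TransitionDensity

variable {Ω : Type*} [MeasurableSpace Ω] {n : ℕ} {P : Measure Ω} [IsProbabilityMeasure P]
  {X : ℝ≥0 → Ω → EuclideanSpace ℝ (Fin n)} {p : ℝ≥0 → EuclideanSpace ℝ (Fin n) → ℝ}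

theorem IsTransitionDensity.integrable (hX : IsLevyProcess P X)
    (hp : IsTransitionDensity P X p) {t : ℝ≥0} (ht : 0 < t) : Integrable (p t) := by
  obtain ⟨hm, h0, hd⟩ := hp t ht
  have := hX.isProbabilityMeasure_map t
  refine ⟨hm.aestronglyMeasurable, ?_⟩
  rw [hasFiniteIntegral_iff_ofReal (.of_forall h0), ← setLIntegral_univ,
    ← withDensity_apply _ MeasurableSet.univ, ← hd]
  exact measure_lt_top _ _

theorem IsTransitionDensity.setIntegral_eq {P : Measure Ω} (hp : IsTransitionDensity P X p)
    {t : ℝ≥0} (ht : 0 < t) {s : Set (EuclideanSpace ℝ (Fin n))} (hs : MeasurableSet s) :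
    ∫ x in s, p t x = (P.map (X t)).real s := by
  obtain ⟨hm, h0, hd⟩ := hp t ht
  rw [integral_eq_lintegral_of_nonneg_ae (.of_forall h0) hm.aestronglyMeasurable,
    measureReal_def, hd, withDensity_apply _ hs]

theorem IsTransitionDensity.integral_eq_one (hX : IsLevyProcess P X)
    (hp : IsTransitionDensity P X p) {t : ℝ≥0} (ht : 0 < t) : ∫ x, p t x = 1 := by
  have := hX.isProbabilityMeasure_map t
  rw [← setIntegral_univ, hp.setIntegral_eq ht MeasurableSet.univ]
  simp

theorem exists_isTransitionDensity (hX : IsLevyProcess P X)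
    (hφ : ∀ t, 0 < t → Integrable (charFun (P.map (X t)))) :
    ∃ p, IsTransitionDensity P X p := by
  refine ⟨fun t x => max (charFunInv (charFun (P.map (X t))) x).re 0, fun t ht =>
    ⟨?_, fun x => le_max_right _ _, ?_⟩⟩
  · exact (Complex.measurable_re.comp (continuous_charFunInv (hφ t ht)).measurable).max
      measurable_const
  · have := hX.isProbabilityMeasure_map t
    simpa [ENNReal.ofReal_max] using eq_withDensity_of_integrable_charFun _ (hφ t ht)

theorem abs_max_re_zero_sub_le_norm (z w : ℂ) : |max z.re 0 - max w.re 0| ≤ ‖z - w‖ :=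
  (abs_max_sub_max_le_abs _ _ _).trans (by simpa using Complex.abs_re_le_norm (z - w))

theorem setIntegral_abs_sub_le {α : Type*} [MeasurableSpace α] {μ : Measure α} {f g : α → ℝ}
    (hf : Integrable f μ) (hg : Integrable g μ) (hf0 : ∀ x, 0 ≤ f x) (hg0 : ∀ x, 0 ≤ g x)
    (s : Set α) : ∫ x in s, |f x - g x| ∂μ ≤ (∫ x in s, f x ∂μ) + ∫ x in s, g x ∂μ := by
  rw [← integral_add hf.integrableOn hg.integrableOn]
  refine integral_mono (hf.sub hg).abs.integrableOn (hf.add hg).integrableOn fun x => ?_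
  exact abs_sub_le_iff.2 ⟨by linarith [hf0 x, hg0 x], by linarith [hf0 x, hg0 x]⟩

end TransitionDensity

/-! ### The two `L¹` estimates -/

theorem lemma2p4 {Ω : Type*} [MeasurableSpace Ω] (P : Measure Ω) [IsProbabilityMeasure P]
    (n : ℕ) (hn : 1 ≤ n)
    (X : ℝ≥0 → Ω → EuclideanSpace ℝ (Fin n)) (hX : IsLevyProcess P X)
    (Ψ : EuclideanSpace ℝ (Fin n) → ℂ) (hΨ : IsCharExponent P X Ψ)
    (βinf : ℝ) (hβinf : βinf ∈ Set.Ioo (0 : ℝ) 2)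
    (hinf : lowerIndexAtInfinity Ψ = (βinf : EReal))
    (β₀ : ℝ) (hβ₀ : β₀ ∈ Set.Ioo (0 : ℝ) 1)
    (hzero : IntegrableOn (fun ξ => ‖Ψ ξ‖ / ‖ξ‖ ^ ((n : ℝ) + β₀))
      (Metric.closedBall (0 : EuclideanSpace ℝ (Fin n)) 1)) :
    (∃ p, IsTransitionDensity P X p) ∧
    ∀ T : ℝ, 0 < T → ∀ κ ∈ Set.Ioo (0 : ℝ) (β₀ / 2), ∃ C : ℝ, 0 < C ∧
      ∀ p, IsTransitionDensity P X p →
      ∀ θ ∈ Set.Ioo (0 : ℝ) 1, ∀ t : ℝ≥0, 0 < t → (t : ℝ) < T →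
        (∀ τ ∈ Set.Ioo (0 : ℝ) 1, ∀ h : EuclideanSpace ℝ (Fin n), ‖h‖ ≤ 1 →
          ∫ x, |p t (x + h) - p t x| ≤
            C * (‖h‖ ^ θ / (t : ℝ) ^ ((θ + n) / βinf + κ)) ^ (τ * β₀ / (n + β₀))) ∧
        (∀ ω ∈ Set.Ioo (0 : ℝ) 1, ∀ ε : ℝ≥0, 0 < ε →
          ∫ x, |p (t + ε) x - p t x| ≤
            C * ((ε : ℝ) ^ θ / (t : ℝ) ^ ((2 * θ + n) / βinf + κ)) ^ (ω * β₀ / (n + β₀))) := by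
  have hβ := hβinf.1
  have hb0 := hβ₀.1
  have hφ : ∀ t, 0 < t → Integrable (charFun (P.map (X t))) := fun t ht =>
    integrable_charFun_of_lowerIndex hn hX hΨ hβ hinf ht
  refine ⟨exists_isTransitionDensity hX hφ, fun T hT κ hκ => ?_⟩
  have hκ0 := hκ.1
  set S := max T 1 with hS
  have hS1 : 1 ≤ S := le_max_right _ _
  obtain ⟨C₁, hC₁0, hC₁⟩ := exists_norm_charFunInv_add_sub_le hn hX hΨ hβ hinf hκ0 hS1
  obtain ⟨C₂, hC₂0, hC₂⟩ := exists_norm_charFunInv_time_sub_le hn hX hΨ hβ hinf hκ0 hS1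
  -- The horizon `S + 1` also covers the time `t + ε` when `ε ≤ 1`.
  obtain ⟨C₃, hC₃0, hC₃⟩ := exists_measureReal_le_norm_le hX hΨ hb0
    (by linarith : (0 : ℝ) ≤ S + 1) hzero
  -- The 3 counts one tail at radius `R` and one at radius `R/2`, the latter costing a factor at
  -- most 2 because `β₀ < 1`.
  set K := C₁ + C₂ + 3 * C₃ with hK
  have hK0 : 0 < K := by positivity
  set D := 2 + (volume.real (Metric.ball (0 : EuclideanSpace ℝ (Fin n)) 1) * 2 ^ n + 1) * K with hD
  have hD0 : 0 < D := by positivity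
  -- An upper bound, uniform in `θ`, for the power of `t` in the time estimate; it serves the case
  -- `ε ≥ 1`.
  set L := S ^ ((2 + n) / βinf + κ) with hL
  have hL1 : 1 ≤ L := Real.one_le_rpow hS1 (by positivity)
  refine ⟨D + 2 * L, by positivity, fun p hp θ hθ t ht htT => ?_⟩
  have ht0 : (0 : ℝ) < t := ht
  have hθ0 := hθ.1
  have htS : (t : ℝ) ≤ S := htT.le.trans (le_max_left _ _)
  have hpi := hp.integrable hX ht
  have hp0 : ∀ x, 0 ≤ p t x := (hp t ht).2.1
  have hp1 := hp.integral_eq_one hX ht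
  have hball : ∀ R : ℝ, MeasurableSet {x : EuclideanSpace ℝ (Fin n) | R ≤ ‖x‖} := fun R =>
    measurableSet_le measurable_const measurable_norm
  have hae : ∀ t, 0 < t → ∀ᵐ x, p t x = max (charFunInv (charFun (P.map (X t))) x).re 0 :=
    fun t ht => by
      have := hX.isProbabilityMeasure_map t
      obtain ⟨hm, h0, hd⟩ := hp t ht
      exact density_ae_eq_charFunInv _ (hφ t ht) hm h0 hd
  have hhalf : ∀ R : ℝ, 2 ≤ R → (R / 2) ^ (-β₀) ≤ 2 * R ^ (-β₀) := fun R hR => by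
    rw [Real.div_rpow (by linarith) two_pos.le, Real.rpow_neg two_pos.le, div_inv_eq_mul, mul_comm]
    have : (2 : ℝ) ^ β₀ ≤ 2 ^ (1 : ℝ) :=
      Real.rpow_le_rpow_of_exponent_le one_le_two hβ₀.2.le
    rw [Real.rpow_one] at this
    gcongr
  refine ⟨fun τ hτ h hh => ?_, fun ω hω ε hε => ?_⟩
  -- The interpolation requires `A > 0`, so `h = 0` is treated apart.
  · rcases eq_or_ne h 0 with rfl | hne
    · simp only [add_zero, sub_self, abs_zero, integral_zero]
      positivity
    have hh0 : 0 < ‖h‖ := norm_pos_iff.2 hne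
    set A := ‖h‖ ^ θ / (t : ℝ) ^ ((θ + n) / βinf + κ) with hA
    have hA0 : 0 < A := by positivity
    have hpih : Integrable fun x => p t (x + h) := hpi.comp_add_right h
    have hmain : ∫ x, |p t (x + h) - p t x| ≤ D * A ^ (τ * β₀ / (n + β₀)) := by
      refine integral_abs_le_of_sup_le_of_tail_le (hpih.sub hpi) hA0 hK0.le hb0 hτ ?_ ?_ ?_
      · have hshift := (measurePreserving_add_right
          (volume : Measure (EuclideanSpace ℝ (Fin n))) h).quasiMeasurePreserving.ae (hae t ht)
        filter_upwards [hae t ht, hshift] with x hx hxh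
        rw [hx, hxh]
        refine (abs_max_re_zero_sub_le_norm _ _).trans ((hC₁ θ hθ t ht htS h x).trans ?_)
        gcongr
        linarith
      · intro R hR
        refine (setIntegral_abs_sub_le hpih hpi (fun x => hp0 _) hp0 _).trans ?_
        -- Since `‖h‖ ≤ 1 ≤ R/2`, translating the tail set by `h` keeps it outside the ball of
        -- radius `R/2`.
        have h1 : ∫ x in {x : EuclideanSpace ℝ (Fin n) | R ≤ ‖x‖}, p t (x + h) ≤
            C₃ * (R / 2) ^ (-β₀) := by
          refine (setIntegral_le_setIntegral_comp_add_right
            (t := {x : EuclideanSpace ℝ (Fin n) | R / 2 ≤ ‖x‖}) hp0 hpi.integrableOn h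
            fun x hx => ?_).trans ?_
          · have h2 : ‖x‖ ≤ ‖x + h‖ + ‖h‖ := by simpa using norm_sub_le (x + h) h
            have hx' : R ≤ ‖x‖ := hx
            change R / 2 ≤ ‖x + h‖
            linarith
          · rw [hp.setIntegral_eq ht (hball _)]
            exact hC₃ t (by linarith) _ (by linarith)
        have h2 : ∫ x in {x : EuclideanSpace ℝ (Fin n) | R ≤ ‖x‖}, p t x ≤ C₃ * R ^ (-β₀) := by
          rw [hp.setIntegral_eq ht (hball _)]
          exact hC₃ t (by linarith) _ (by linarith)
        have h3 : C₃ * (R / 2) ^ (-β₀) ≤ C₃ * (2 * R ^ (-β₀)) := by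
          gcongr; exact hhalf R hR
        have hR0 : 0 ≤ R ^ (-β₀) := Real.rpow_nonneg (by linarith) _
        rw [hK]
        nlinarith
      · rw [← setIntegral_univ]
        refine (setIntegral_abs_sub_le hpih hpi (fun x => hp0 _) hp0 _).trans ?_
        rw [setIntegral_univ, setIntegral_univ, integral_add_right_eq_self (p t) h, hp1]
        norm_num
    refine hmain.trans ?_
    gcongr
    linarith
  · have hε0 : (0 : ℝ) < ε := hε
    have htε : 0 < t + ε := by positivity
    have hω0 := hω.1
    have hqi := hp.integrable hX htε
    have hq0 : ∀ x, 0 ≤ p (t + ε) x := (hp _ htε).2.1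
    have hq1 := hp.integral_eq_one hX htε
    set A := (ε : ℝ) ^ θ / (t : ℝ) ^ ((2 * θ + n) / βinf + κ) with hA
    have hA0 : 0 < A := by positivity
    have htot : ∫ x, |p (t + ε) x - p t x| ≤ 2 := by
      rw [← setIntegral_univ]
      refine (setIntegral_abs_sub_le hqi hpi hq0 hp0 _).trans ?_
      rw [setIntegral_univ, setIntegral_univ, hp1, hq1]
      norm_num
    rcases le_total (ε : ℝ) 1 with hε1 | hε1
    · have hmain : ∫ x, |p (t + ε) x - p t x| ≤ D * A ^ (ω * β₀ / (n + β₀)) := by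
        refine integral_abs_le_of_sup_le_of_tail_le (hqi.sub hpi) hA0 hK0.le hb0 hω ?_ ?_ htot
        · filter_upwards [hae t ht, hae _ htε] with x hx hxε
          rw [hx, hxε]
          refine (abs_max_re_zero_sub_le_norm _ _).trans ((hC₂ θ hθ t ht htS ε x).trans ?_)
          gcongr
          linarith
        · intro R hR
          refine (setIntegral_abs_sub_le hqi hpi hq0 hp0 _).trans ?_
          rw [hp.setIntegral_eq ht (hball _), hp.setIntegral_eq htε (hball _)]
          have h1 := hC₃ t (by linarith) R (by linarith)
          have h2 := hC₃ (t + ε) (by push_cast; linarith) R (by linarith)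
          have hR0 : 0 ≤ R ^ (-β₀) := Real.rpow_nonneg (by linarith) _
          rw [hK]
          nlinarith
      refine hmain.trans ?_
      gcongr
      linarith
    -- For `ε ≥ 1` no tail bound at time `t + ε` is needed: `A ≥ 1/L` and the exponent is at most 1,
    -- so the right-hand side already exceeds the total mass 2.
    · have hexp : ω * β₀ / (n + β₀) ≤ 1 := by
        rw [div_le_one (by positivity)]
        have : ω * β₀ ≤ 1 * β₀ := by gcongr; exact hω.2.le
        linarith [Nat.cast_nonneg (α := ℝ) n]
      have hAL : L⁻¹ ≤ A := by
        rw [hA, ← one_div]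
        gcongr
        · exact Real.one_le_rpow hε1 hθ0.le
        · calc (t : ℝ) ^ ((2 * θ + n) / βinf + κ) ≤ S ^ ((2 * θ + n) / βinf + κ) := by gcongr
            _ ≤ L := by
              refine Real.rpow_le_rpow_of_exponent_le hS1 ?_
              gcongr
              linarith [hθ.2]
      have h1 : L⁻¹ ≤ A ^ (ω * β₀ / (n + β₀)) :=
        calc L⁻¹ = L⁻¹ ^ (1 : ℝ) := (Real.rpow_one _).symm
          _ ≤ L⁻¹ ^ (ω * β₀ / (n + β₀)) := Real.rpow_le_rpow_of_exponent_ge (by positivity)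
              (inv_le_one_of_one_le₀ hL1) hexp
          _ ≤ _ := by gcongr
      have hL0 : 0 < L := by positivity
      calc ∫ x, |p (t + ε) x - p t x| ≤ 2 := htot
        _ = 2 * L * L⁻¹ := by field_simp
        _ ≤ 2 * L * A ^ (ω * β₀ / (n + β₀)) := by gcongr
        _ ≤ _ := by gcongr; linarith
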